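/- Let $G$ be a finite simple nonseparable graph (connected, at least two vertices, no cut vertex). A rotation $\sigma$ of $G$ is a cyclic order of the edges at every vertex; it induces closed walks (face walks): after traversing an edge into a vertex $w$, continue with the edge that follows it in the rotation at $w$. Assume that $(G,\sigma)$ is a plane topological drawing: every induced walk is a simple cycle, and some of these face cycles form a basis of the cycle space of $G$ over $\mathrm{GF}(2)$ in which every edge lies in at most two basis cycles (MacLane's criterion). The ring sum of a family of cycles is the set of edges contained in an odd number of them. Let $C$ be a simple cycle of $G$ (for instance a face cycle), let $u\neq v$ be vertices of $C$, and let $P$ be a simple path from $u$ to $v$ that has no vertex in common with $C$ except $u,v$, and no edge in common with $C$. Cut the drawing along $C\cup P$. The two parts adjacent to $P$ are the sets $F_1,F_2$ of faces which can be reached from the faces on one side, respectively on the other side, of the edges of $P$ by crossing only edges outside $C\cup P$. An edge is inside $F_i$ if it lies on a face of $F_i$ and not in $C\cup P$; an inner vertex of $F_i$ is a vertex of a face of $F_i$ that does not lie on $C\cup P$. Then $u,v$ divide $C$ into two edge-disjoint arcs $A_1,A_2$ (simple paths from $u$ to $v$ whose union is $C$), which can be numbered so that for $i=1,2$: 1.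 $A_i\cup P$ is (the edge set of) a simple cycle; it passes through all edges of $P$. 2. If there are edges inside $F_i$, then the ring sum of all face cycles that pass through at least one edge inside $F_i$ is exactly $A_i\cup P$. 3. In particular, if $F_i$ has inner vertices and every edge inside $F_i$ is incident to an inner vertex of $F_i$, then the ring sum of all face cycles that pass through at least one edge incident to an inner vertex of $F_i$ is exactly $A_i\cup P$. 4. If there are no edges inside $F_i$, then $F_i$ consists of a single face, whose cycle is $A_i\cup P$. -/

import Mathlib

open Classical in
/-- The subspace of quasicycles over `GF(2)`: sets of edges (given by their characteristic
vectors) which have even degree at every vertex. -/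
noncomputable def quasicycleSpace {V : Type*} [Fintype V] (G : SimpleGraph V) :
    Submodule (ZMod 2) (G.edgeSet → ZMod 2) where
  carrier := {x | ∀ v : V, ∑ e : G.edgeSet with v ∈ e.1, x e = 0}
  zero_mem' := by intro v; simp
  add_mem' := by
    intro x y hx hy v
    have h1 := hx v
    have h2 := hy v
    simp only [Pi.add_apply, Finset.sum_add_distrib, h1, h2, add_zero]
  smul_mem' := by
    intro c x hx v
    have h1 := hx v
    simp only [Pi.smul_apply, ← Finset.smul_sum, h1, smul_zero]

/-- A nonseparable graph: connected, with at least two vertices, and without cut vertices. -/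
def IsNonseparable {V : Type*} (G : SimpleGraph V) : Prop :=
  G.Connected ∧ Nontrivial V ∧ ∀ v : V, (G.induce ({v}ᶜ : Set V)).Preconnected

/-- A set of edges is a simple cycle if it is the edge set of a closed walk of length at least
three without repeated vertices. -/
def IsSimpleCycleSet {V : Type*} (G : SimpleGraph V) (S : Set (Sym2 V)) : Prop :=
  ∃ (a : V) (w : G.Walk a a), w.IsCycle ∧ w.edgeSet = S

/-- A rotation of a graph: a cyclic order of the edges at every vertex. An edge `e` at a vertex `v`
is represented by the dart (directed edge) along `e` that starts at `v`. -/
structure GraphRotation {V : Type*} (G : SimpleGraph V) where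
  /-- the next dart at the same starting vertex -/
  next : Equiv.Perm G.Dart
  fst_next : ∀ d, (next d).fst = d.fst
  sameCycle_of_fst_eq : ∀ d d' : G.Dart, d.fst = d'.fst → next.SameCycle d d'

namespace GraphRotation

variable {V : Type*} {G : SimpleGraph V}

/-- One step of a walk induced by the rotation: having run through `d` from `v` to `w`, continue
with the edge which follows the edge of `d` in the rotation at `w`. -/
def faceStep (σ : GraphRotation G) : Equiv.Perm G.Dart :=
  (SimpleGraph.Dart.symm_involutive (G := G)).toPerm.trans σ.next

/-- The closed walks induced by the rotation (the face walks), as orbits of `faceStep`. -/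
def Face (σ : GraphRotation G) : Type _ :=
  Quotient (Equiv.Perm.SameCycle.setoid σ.faceStep)

/-- The face whose walk runs through the dart `d`. -/
def faceOf (σ : GraphRotation G) (d : G.Dart) : σ.Face :=
  Quotient.mk (Equiv.Perm.SameCycle.setoid σ.faceStep) d

/-- The edges of a face walk. -/
def faceEdges (σ : GraphRotation G) (f : σ.Face) : Set (Sym2 V) :=
  {e | ∃ d : G.Dart, σ.faceOf d = f ∧ d.edge = e}

/-- The vertices of a face walk. -/
def faceVertices (σ : GraphRotation G) (f : σ.Face) : Set V :=
  {x | ∃ d : G.Dart, σ.faceOf d = f ∧ d.fst = x}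

/-- The face walk is a simple cycle. -/
def FaceIsSimpleCycle (σ : GraphRotation G) (f : σ.Face) : Prop :=
  ∃ (a : V) (w : G.Walk a a), w.IsCycle ∧ ∀ d : G.Dart, d ∈ w.darts ↔ σ.faceOf d = f

open Classical in
/-- The characteristic vector over `GF(2)` of the edge set of a face walk. -/
noncomputable def faceVector (σ : GraphRotation G) (f : σ.Face) : G.edgeSet → ZMod 2 :=
  fun e => if e.1 ∈ σ.faceEdges f then 1 else 0

/-- MacLane's planarity criterion for the induced system of cycles: some of them form a basis of
the subspace of quasicycles such that every edge belongs to at most two cycles of the basis. -/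
def SatisfiesMacLane [Fintype V] (σ : GraphRotation G) : Prop :=
  ∃ B : Set σ.Face,
    LinearIndepOn (ZMod 2) σ.faceVector B ∧
    Submodule.span (ZMod 2) (σ.faceVector '' B) = quasicycleSpace G ∧
    ∀ e ∈ G.edgeSet, {f ∈ B | e ∈ σ.faceEdges f}.encard ≤ 2

/-- A plane topological drawing: a rotation which induces a system of simple cycles that satisfies
MacLane's planarity criterion. -/
def IsPlaneDrawing [Fintype V] (σ : GraphRotation G) : Prop :=
  (∀ f : σ.Face, σ.FaceIsSimpleCycle f) ∧ σ.SatisfiesMacLane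

/-- The ring sum (sum modulo 2) of the face cycles in `F`: the edges which belong to an odd number
of them. -/
def ringSum (σ : GraphRotation G) (F : Set σ.Face) : Set (Sym2 V) :=
  {e | Odd {f ∈ F | e ∈ σ.faceEdges f}.ncard}

/-- Two faces are adjacent across an edge that does not belong to `T`. -/
def AdjacentOff (σ : GraphRotation G) (T : Set (Sym2 V)) (f g : σ.Face) : Prop :=
  ∃ e, e ∉ T ∧ e ∈ σ.faceEdges f ∧ e ∈ σ.faceEdges g

/-- The part of the drawing next to the darts in `D` when the drawing is cut along the edges in `T`:
the faces which can be reached from a face at a dart of `D` without crossing an edge of `T`. -/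
def part (σ : GraphRotation G) (T : Set (Sym2 V)) (D : Set G.Dart) : Set σ.Face :=
  {f | ∃ d ∈ D, Relation.ReflTransGen (σ.AdjacentOff T) (σ.faceOf d) f}

/-- The edges inside the part `F`: edges of its faces, other than the cutting edges `T`. -/
def innerEdges (σ : GraphRotation G) (T : Set (Sym2 V)) (F : Set σ.Face) : Set (Sym2 V) :=
  {e | e ∉ T ∧ ∃ f ∈ F, e ∈ σ.faceEdges f}

/-- The inner vertices of the part `F`: vertices of its faces which lie on no cutting edge. -/
def innerVertices (σ : GraphRotation G) (T : Set (Sym2 V)) (F : Set σ.Face) : Set V :=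
  {x | (∀ e ∈ T, x ∉ e) ∧ ∃ f ∈ F, x ∈ σ.faceVertices f}

/-- The edges of the graph which are incident to an inner vertex of the part `F`. -/
def edgesAtInnerVertices (σ : GraphRotation G) (T : Set (Sym2 V)) (F : Set σ.Face) :
    Set (Sym2 V) :=
  {e ∈ G.edgeSet | ∃ x ∈ σ.innerVertices T F, x ∈ e}

/-- The face cycles which pass through at least one edge of `S`. -/
def facesThrough (σ : GraphRotation G) (S : Set (Sym2 V)) : Set σ.Face :=
  {f | ∃ e ∈ S, e ∈ σ.faceEdges f}

/-- For the part `F` (of the drawing cut along `T`) that lies between the path with edge set `P`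
and the arc with edge set `A`: the set `A ∪ P` is a simple cycle, and it is the ring sum of the face
cycles through the edges inside the part; these edges can be replaced by the edges incident to the
inner vertices when the part has inner vertices and each edge inside it is incident to one of them;
and if there are no edges inside the part, then it is a single face, bounded by `A ∪ P`. -/
def PartGivesCycle (σ : GraphRotation G) (T : Set (Sym2 V)) (F : Set σ.Face)
    (A P : Set (Sym2 V)) : Prop :=
  IsSimpleCycleSet G (A ∪ P) ∧
  ((σ.innerEdges T F).Nonempty → σ.ringSum (σ.facesThrough (σ.innerEdges T F)) = A ∪ P) ∧
  ((σ.innerVertices T F).Nonempty →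
    (∀ e ∈ σ.innerEdges T F, ∃ x ∈ σ.innerVertices T F, x ∈ e) →
    σ.ringSum (σ.facesThrough (σ.edgesAtInnerVertices T F)) = A ∪ P) ∧
  (σ.innerEdges T F = ∅ → ∃ f, F = {f} ∧ σ.faceEdges f = A ∪ P)

end GraphRotation

/-! Let `T` be the theta graph made of `P` and the two arcs `A`, `B` of the cycle. Every face walk
is a simple cycle, so each edge lies on exactly two faces, and a ring sum of faces consists of the
edges with exactly one of their two faces in the family. Hence the ring sum of a component of the
drawing cut along `T` lies in `T`.

Turning around an inner vertex of one of the three paths shows that the component next to the path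
does not change along either side. The ring sum of a component therefore contains each path entirely
or not at all. It is also a quasicycle, which excludes `P` alone and all of `T`. If it contains `P`,
it is `A ∪ P` or `B ∪ P` (`ringSum_component_eq_of_theta`).

By MacLane's criterion the cycles `A ∪ P` and `B ∪ P` are ring sums of face sets `R` and `R'`. These
separate the two sides of `P`, so the ring sums of both adjacent components contain `P`. Were the
two ring sums equal, connectedness (`eq_of_ringSum_eq`) would make the components complementary,
which forces `R = R'ᶜ` and `A ∪ P = B ∪ P`. The claims about inner edges and vertices then follow by
describing the component (`partGivesCycle_of_component`). -/

open SimpleGraph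

/-! ### Paths, and the arcs of a cycle -/

namespace SimpleGraph

instance Dart.instFinite {V : Type*} [Finite V] (G : SimpleGraph V) : Finite G.Dart :=
  Finite.of_injective _ (Dart.toProd_injective (G := G))

namespace Walk

variable {V : Type*} {G : SimpleGraph V} {u v : V}

/-- A walk without repeated edges runs through no edge in both directions. -/
theorem IsTrail.symm_notMem_darts {p : G.Walk u v} (hp : p.IsTrail) {d : G.Dart}
    (hd : d ∈ p.darts) : d.symm ∉ p.darts := fun hd' =>
  d.symm_ne (List.inj_on_of_nodup_map hp.edges_nodup hd' hd d.edge_symm)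

theorem IsPath.eq_of_fst_eq {p : G.Walk u v} (hp : p.IsPath) {d d' : G.Dart}
    (hd : d ∈ p.darts) (hd' : d' ∈ p.darts) (h : d.fst = d'.fst) : d = d' := by
  refine List.inj_on_of_nodup_map (f := fun d : G.Dart => d.fst) ?_ hd hd' h
  rw [map_fst_darts]
  exact hp.support_nodup.sublist (List.dropLast_sublist _)

theorem IsPath.eq_of_snd_eq {p : G.Walk u v} (hp : p.IsPath) {d d' : G.Dart}
    (hd : d ∈ p.darts) (hd' : d' ∈ p.darts) (h : d.snd = d'.snd) : d = d' := by
  refine List.inj_on_of_nodup_map (f := fun d : G.Dart => d.snd) ?_ hd hd' h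
  rw [map_snd_darts]
  exact hp.support_nodup.sublist (List.tail_sublist _)

theorem IsPath.fst_ne_end {p : G.Walk u v} (hp : p.IsPath) {d : G.Dart}
    (hd : d ∈ p.darts) : d.fst ≠ v := by
  induction p with
  | nil => simp at hd
  | cons h p ih =>
    rw [cons_isPath_iff] at hp
    rw [darts_cons, List.mem_cons] at hd
    rcases hd with rfl | hd
    · rintro rfl
      exact hp.2 p.end_mem_support
    · exact ih hp.1 hd

theorem IsPath.snd_ne_start {p : G.Walk u v} (hp : p.IsPath) {d : G.Dart}
    (hd : d ∈ p.darts) : d.snd ≠ u := by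
  have h := hp.reverse.fst_ne_end (d := d.symm) (by
    rw [darts_reverse, List.mem_reverse]
    exact List.mem_map.2 ⟨d, hd, rfl⟩)
  exact h

theorem mem_darts_or_symm_mem_darts {p : G.Walk u v} {d : G.Dart} (hd : d.edge ∈ p.edges) :
    d ∈ p.darts ∨ d.symm ∈ p.darts := by
  obtain ⟨d', hd', h⟩ := List.mem_map.1 hd
  rcases (dart_edge_eq_iff d' d).1 h with rfl | rfl
  · exact .inl hd'
  · exact .inr hd'

theorem edge_mem_edges {p : G.Walk u v} {d : G.Dart} (hd : d ∈ p.darts) : d.edge ∈ p.edges :=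
  List.mem_map_of_mem hd

theorem exists_mem_darts {p : G.Walk u v} (h : u ≠ v) : ∃ d, d ∈ p.darts := by
  cases p with
  | nil => exact absurd rfl h
  | cons h p => exact ⟨_, by rw [darts_cons]; exact List.mem_cons_self⟩

/-- Two paths with the same ends and without further common vertices or edges form a cycle. -/
theorem IsPath.isSimpleCycleSet_union {p q : G.Walk u v} (hp : p.IsPath) (hq : q.IsPath)
    (huv : u ≠ v) (h : ∀ x ∈ p.support, x ∈ q.support → x = u ∨ x = v)
    (he : Disjoint p.edgeSet q.edgeSet) : IsSimpleCycleSet G (p.edgeSet ∪ q.edgeSet) := by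
  refine ⟨u, p.append q.reverse, hp.isCycle_append hq.reverse ?_ ?_,
    by rw [edgeSet_append, edgeSet_reverse]⟩
  · intro x hx hx'
    have hxq : x ∈ q.support := by
      simpa using List.mem_of_mem_tail hx'
    rcases h x (List.mem_of_mem_tail hx) hxq with rfl | rfl
    · have := hp.support_nodup
      rw [← cons_tail_support] at this
      exact (List.nodup_cons.1 this).1 hx
    · have := hq.reverse.support_nodup
      rw [← cons_tail_support] at this
      exact (List.nodup_cons.1 this).1 hx'
  -- Two paths of length one would both be the edge `uv`, against disjointness.
  · by_contra! hl
    rw [length_reverse] at hl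
    cases p with
    | nil => exact huv rfl
    | cons a p =>
      cases q with
      | nil => exact huv rfl
      | cons b q =>
        cases p with
        | cons => simp at hl
        | nil =>
          cases q with
          | cons => simp at hl
          | nil => simp at he

/-- Two vertices of a cycle divide it into two paths. -/
theorem IsCycle.exists_arcs {c : V} {C : G.Walk c c} (hC : C.IsCycle) (huv : u ≠ v)
    (hu : u ∈ C.support) (hv : v ∈ C.support) :
    ∃ A B : G.Walk u v, A.IsPath ∧ B.IsPath ∧
      (∀ x ∈ A.support, x ∈ B.support → x = u ∨ x = v) ∧
      Disjoint A.edgeSet B.edgeSet ∧ A.edgeSet ∪ B.edgeSet = C.edgeSet ∧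
      A.support ⊆ C.support ∧ B.support ⊆ C.support := by
  classical
  -- Start the cycle at `u` and cut it at `v`; the second piece is reversed.
  have hD : (C.rotate u hu).IsCycle := hC.rotate hu
  have hvD : v ∈ (C.rotate u hu).support := by simpa using hv
  have hDe : (C.rotate u hu).edgeSet = C.edgeSet := by
    ext e
    exact (C.rotate_edges u hu).mem_iff
  have hDs : ∀ x ∈ (C.rotate u hu).support, x ∈ C.support := by simp
  generalize C.rotate u hu = D at *
  have hDp : ((D.takeUntil v hvD).append (D.dropUntil v hvD)) = D := D.take_spec hvD
  generalize D.takeUntil v hvD = A at *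
  generalize D.dropUntil v hvD = B at *
  subst hDp
  refine ⟨A, B.reverse, hD.isPath_of_append_left (not_nil_of_ne huv.symm),
    (hD.isPath_of_append_right (not_nil_of_ne huv)).reverse, ?_, ?_, ?_, ?_, ?_⟩
  · intro x hxA hxB
    have hn := hD.2
    rw [tail_support_append, List.nodup_append'] at hn
    rw [support_reverse, List.mem_reverse] at hxB
    by_contra! hx
    have h1 := (mem_support_iff A).1 hxA
    have h2 := (mem_support_iff B).1 hxB
    exact hn.2.2 (h1.resolve_left hx.1) (h2.resolve_left hx.2)
  · have hn := hD.1.1.edges_nodup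
    rw [edges_append, List.nodup_append'] at hn
    rw [edgeSet_reverse]
    exact Set.disjoint_left.2 fun e h1 h2 => hn.2.2 h1 h2
  · rw [← hDe, edgeSet_append, edgeSet_reverse]
  · exact fun x hx => hDs x (by simp [hx])
  · intro x hx
    rw [support_reverse, List.mem_reverse] at hx
    exact hDs x (by simp [hx])

end Walk

end SimpleGraph

/-! ### Edge sets as vectors over `GF(2)` -/

open Classical in
/-- The characteristic vector over `GF(2)` of a set of edges. -/
noncomputable def edgeVector {V : Type*} (G : SimpleGraph V) (S : Set (Sym2 V)) :
    G.edgeSet → ZMod 2 :=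
  fun e => if e.1 ∈ S then 1 else 0

section EdgeVector

variable {V : Type*} {G : SimpleGraph V}

theorem edgeVector_union {S S' : Set (Sym2 V)} (h : Disjoint S S') :
    edgeVector G (S ∪ S') = edgeVector G S + edgeVector G S' := by
  funext e
  have hd : e.1 ∈ S → e.1 ∉ S' := fun h1 => Set.disjoint_left.1 h h1
  by_cases h1 : e.1 ∈ S <;> by_cases h2 : e.1 ∈ S' <;> simp_all [edgeVector]

theorem edgeVector_injOn {S S' : Set (Sym2 V)} (hS : S ⊆ G.edgeSet) (hS' : S' ⊆ G.edgeSet)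
    (h : edgeVector G S = edgeVector G S') : S = S' := by
  ext e
  by_cases he : e ∈ G.edgeSet
  · have := congrFun h ⟨e, he⟩
    by_cases h1 : e ∈ S <;> by_cases h2 : e ∈ S' <;> simp_all [edgeVector]
  · exact ⟨fun h => absurd (hS h) he, fun h => absurd (hS' h) he⟩

theorem IsSimpleCycleSet.subset_edgeSet {S : Set (Sym2 V)} (h : IsSimpleCycleSet G S) :
    S ⊆ G.edgeSet := by
  obtain ⟨a, w, hw, rfl⟩ := h
  exact fun e he => w.edges_subset_edgeSet he

variable [Fintype V]

open Classical in
theorem sum_edgeVector_edgeSet {u v : V} {p : G.Walk u v} (hp : p.IsTrail) (x : V) :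
    ∑ e : G.edgeSet with x ∈ e.1, edgeVector G p.edgeSet e
      = (p.edges.countP fun e => x ∈ e : ℕ) := by
  simp only [edgeVector, Finset.sum_boole]
  congr 1
  rw [List.countP_eq_length_filter, ← List.toFinset_card_of_nodup (hp.edges_nodup.filter _)]
  refine Finset.card_bij (fun e _ => e.1) ?_ ?_ ?_
  · intro e he
    simpa [and_comm] using he
  · exact fun _ _ _ _ h => Subtype.ext h
  · intro e he
    have he' : e ∈ p.edges ∧ x ∈ e := by simpa using he
    exact ⟨⟨e, p.edges_subset_edgeSet he'.1⟩, by simpa [and_comm] using he', rfl⟩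

/-- A trail has odd degree only at its two ends, and there only if they differ. -/
theorem edgeVector_mem_quasicycleSpace_iff {u v : V} {p : G.Walk u v} (hp : p.IsTrail) :
    edgeVector G p.edgeSet ∈ quasicycleSpace G ↔ u = v := by
  classical
  have key : edgeVector G p.edgeSet ∈ quasicycleSpace G ↔ ∀ x, (u ≠ v → x ≠ u ∧ x ≠ v) := by
    refine forall_congr' fun x => ?_
    rw [← hp.even_countP_edges_iff x, ← ZMod.natCast_eq_zero_iff_even]
    convert! Iff.rfl using 2
    convert! (sum_edgeVector_edgeSet hp x).symm
  rw [key]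
  constructor
  · intro h
    by_contra huv
    exact (h u huv).1 rfl
  · exact fun h _ h' => absurd h h'

theorem IsSimpleCycleSet.edgeVector_mem {S : Set (Sym2 V)} (h : IsSimpleCycleSet G S) :
    edgeVector G S ∈ quasicycleSpace G := by
  obtain ⟨a, w, hw, rfl⟩ := h
  exact (edgeVector_mem_quasicycleSpace_iff hw.1.1).2 rfl

end EdgeVector

/-! ### Faces and their ring sums -/

namespace GraphRotation

variable {V : Type*} {G : SimpleGraph V} (σ : GraphRotation G)

/-- `next d` is one face step after `d.symm`. Thus passing a dart in the rotation at its vertex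
amounts to crossing its edge. -/
theorem faceOf_next (d : G.Dart) : σ.faceOf (σ.next d) = σ.faceOf d.symm := by
  refine (Quotient.sound ?_ : σ.faceOf d.symm = σ.faceOf (σ.next d)).symm
  refine ⟨1, ?_⟩
  simp [faceStep]

theorem exists_dart_of_mem_edgeSet {e : Sym2 V} (he : e ∈ G.edgeSet) :
    ∃ d : G.Dart, d.edge = e := by
  induction e with
  | h a b => exact ⟨⟨(a, b), he⟩, rfl⟩

theorem edge_mem_faceEdges_iff {d : G.Dart} {f : σ.Face} :
    d.edge ∈ σ.faceEdges f ↔ f = σ.faceOf d ∨ f = σ.faceOf d.symm := by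
  constructor
  · rintro ⟨d', rfl, h⟩
    rcases (dart_edge_eq_iff d' d).1 h with rfl | rfl
    · exact .inl rfl
    · exact .inr rfl
  · rintro (rfl | rfl)
    · exact ⟨d, rfl, rfl⟩
    · exact ⟨d.symm, rfl, d.edge_symm⟩

theorem faceEdges_subset (f : σ.Face) : σ.faceEdges f ⊆ G.edgeSet := by
  rintro e ⟨d, -, rfl⟩
  exact d.edge_mem

theorem faceOf_surjective : Function.Surjective σ.faceOf := Quotient.mk_surjective

instance [Finite V] : Finite σ.Face := Finite.of_surjective _ σ.faceOf_surjective

theorem FaceIsSimpleCycle.faceOf_symm_ne {σ : GraphRotation G} {d : G.Dart}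
    (h : σ.FaceIsSimpleCycle (σ.faceOf d)) : σ.faceOf d.symm ≠ σ.faceOf d := by
  obtain ⟨a, w, hw, hd⟩ := h
  exact fun h => hw.1.1.symm_notMem_darts ((hd d).2 rfl) ((hd _).2 h)

theorem FaceIsSimpleCycle.isSimpleCycleSet {σ : GraphRotation G} {f : σ.Face}
    (h : σ.FaceIsSimpleCycle f) : IsSimpleCycleSet G (σ.faceEdges f) := by
  obtain ⟨a, w, hw, hd⟩ := h
  refine ⟨a, w, hw, ?_⟩
  ext e
  simp [Walk.edges, faceEdges, hd]

theorem ringSum_subset (F : Set σ.Face) : σ.ringSum F ⊆ G.edgeSet := by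
  intro e he
  obtain ⟨f, hf⟩ := Set.nonempty_of_ncard_ne_zero (Odd.pos he).ne'
  exact σ.faceEdges_subset f hf.2

/-- The faces at the two darts of an edge are distinct, and no other face contains the edge; an odd
number therefore means exactly one of the two. -/
theorem edge_mem_ringSum_iff {σ : GraphRotation G} (hσ : ∀ f, σ.FaceIsSimpleCycle f)
    {F : Set σ.Face} {d : G.Dart} :
    d.edge ∈ σ.ringSum F ↔ ¬ (σ.faceOf d ∈ F ↔ σ.faceOf d.symm ∈ F) := by
  have hne := (hσ (σ.faceOf d)).faceOf_symm_ne
  simp only [ringSum, Set.mem_ofPred_eq, edge_mem_faceEdges_iff]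
  by_cases h1 : σ.faceOf d ∈ F <;> by_cases h2 : σ.faceOf d.symm ∈ F
  · have : {f ∈ F | f = σ.faceOf d ∨ f = σ.faceOf d.symm} = {σ.faceOf d, σ.faceOf d.symm} := by
      grind
    rw [this, Set.ncard_pair hne.symm]
    simp [h1, h2]
  · have : {f ∈ F | f = σ.faceOf d ∨ f = σ.faceOf d.symm} = {σ.faceOf d} := by grind
    rw [this, Set.ncard_singleton]
    simp [h1, h2]
  · have : {f ∈ F | f = σ.faceOf d ∨ f = σ.faceOf d.symm} = {σ.faceOf d.symm} := by grind
    rw [this, Set.ncard_singleton]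
    simp [h1, h2]
  · have : {f ∈ F | f = σ.faceOf d ∨ f = σ.faceOf d.symm} = ∅ := by grind
    rw [this, Set.ncard_empty]
    simp [h1, h2]

theorem ringSum_compl {σ : GraphRotation G} (hσ : ∀ f, σ.FaceIsSimpleCycle f) (F : Set σ.Face) :
    σ.ringSum Fᶜ = σ.ringSum F := by
  ext e
  by_cases he : e ∈ G.edgeSet
  · obtain ⟨d, rfl⟩ := exists_dart_of_mem_edgeSet he
    simp only [edge_mem_ringSum_iff hσ, Set.mem_compl_iff]
    tauto
  · exact ⟨fun h => absurd (ringSum_subset _ _ h) he, fun h => absurd (ringSum_subset _ _ h) he⟩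

theorem ringSum_singleton {σ : GraphRotation G} (f : σ.Face) :
    σ.ringSum {f} = σ.faceEdges f := by
  ext e
  change Odd {g ∈ ({f} : Set σ.Face) | e ∈ σ.faceEdges g}.ncard ↔ _
  by_cases he : e ∈ σ.faceEdges f
  · have : {g ∈ ({f} : Set σ.Face) | e ∈ σ.faceEdges g} = {f} := by grind
    rw [this, Set.ncard_singleton]
    simp [he]
  · have : {g ∈ ({f} : Set σ.Face) | e ∈ σ.faceEdges g} = ∅ := by grind
    rw [this, Set.ncard_empty]
    simp [he]

theorem edgeVector_ringSum [Fintype σ.Face] (F : Set σ.Face) [DecidablePred (· ∈ F)] :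
    edgeVector G (σ.ringSum F) = ∑ f with f ∈ F, σ.faceVector f := by
  classical
  funext e
  rw [Finset.sum_apply]
  simp only [faceVector, Finset.sum_boole, Finset.filter_filter]
  have h : {f ∈ F | e.1 ∈ σ.faceEdges f}.ncard
      = (Finset.univ.filter fun f => f ∈ F ∧ e.1 ∈ σ.faceEdges f).card := by
    rw [← Set.ncard_coe_finset]
    simp
  by_cases ho : e.1 ∈ σ.ringSum F
  · rw [edgeVector, if_pos ho, eq_comm, ZMod.natCast_eq_one_iff_odd, ← h]
    exact ho
  · rw [edgeVector, if_neg ho, eq_comm, ZMod.natCast_eq_zero_iff_even, ← h]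
    exact Nat.not_odd_iff_even.1 ho

/-! ### Consequences of MacLane's criterion and of connectedness -/

section Finite

variable [Fintype V]

theorem edgeVector_ringSum_mem {σ : GraphRotation G} (hσ : ∀ f, σ.FaceIsSimpleCycle f)
    (F : Set σ.Face) : edgeVector G (σ.ringSum F) ∈ quasicycleSpace G := by
  classical
  have := Fintype.ofFinite σ.Face
  rw [edgeVector_ringSum]
  exact Submodule.sum_mem _ fun f _ => (hσ f).isSimpleCycleSet.edgeVector_mem

/-- In a drawing which satisfies MacLane's criterion every quasicycle is a ring sum of faces. -/
theorem SatisfiesMacLane.exists_ringSum_eq {σ : GraphRotation G} (h : σ.SatisfiesMacLane)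
    {S : Set (Sym2 V)} (hS : S ⊆ G.edgeSet) (hq : edgeVector G S ∈ quasicycleSpace G) :
    ∃ F, σ.ringSum F = S := by
  classical
  have := Fintype.ofFinite σ.Face
  obtain ⟨B, -, hB, -⟩ := h
  rw [← hB] at hq
  obtain ⟨c, hc⟩ := (Submodule.mem_span_range_iff_exists_fun (ZMod 2)).1
    (Submodule.span_mono (Set.image_subset_range _ _) hq)
  -- Over `GF(2)` a linear combination is the sum of the vectors with coefficient 1.
  refine ⟨{f | c f = 1}, edgeVector_injOn (σ.ringSum_subset _) hS ?_⟩
  rw [edgeVector_ringSum, ← hc, Finset.sum_filter]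
  refine Finset.sum_congr rfl fun f _ => ?_
  have : ∀ a : ZMod 2, a = 0 ∨ a = 1 := by decide
  rcases this (c f) with h | h <;> simp [h]

theorem next_induction {p : G.Dart → Prop} {d d' : G.Dart} (h : d.fst = d'.fst)
    (hp : ∀ a : G.Dart, a.fst = d.fst → p a → p (σ.next a)) (hd : p d) : p d' := by
  obtain ⟨i, -, rfl⟩ := (σ.sameCycle_of_fst_eq d d' h).exists_pow_eq'
  clear h
  have : ((σ.next ^ i) d).fst = d.fst ∧ p ((σ.next ^ i) d) := by
    induction i with
    | zero => exact ⟨rfl, hd⟩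
    | succ i ih =>
      rw [pow_succ', Equiv.Perm.mul_apply]
      exact ⟨(σ.fst_next _).trans ih.1, hp _ ih.1 ih.2⟩
  exact this.2

/-- Rotation is transitive on the darts at a vertex, and reversal moves along an edge, so in a
connected graph the two together reach every dart. -/
theorem dart_induction (hG : G.Preconnected) {p : G.Dart → Prop} {d : G.Dart}
    (hn : ∀ a, p a → p (σ.next a)) (hs : ∀ a : G.Dart, p a → p a.symm) (hd : p d)
    (d' : G.Dart) : p d' := by
  obtain ⟨w⟩ := hG d.fst d'.fst
  have key : ∀ {x y : V} (_ : G.Walk x y) (a b : G.Dart), a.fst = x → b.fst = y → p a → p b := by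
    intro x y w
    induction w with
    | nil => exact fun a b ha hb => σ.next_induction (ha.trans hb.symm) fun c _ => hn c
    | cons h w ih =>
      intro a b ha hb hpa
      refine ih (⟨(_, _), h⟩ : G.Dart).symm b rfl hb (hs _ ?_)
      exact σ.next_induction ha (fun c _ => hn c) hpa
  exact key w d d' rfl rfl hd

/-- Two sets of faces with the same ring sum are equal when they agree at one face. -/
theorem eq_of_ringSum_eq {σ : GraphRotation G} (hG : G.Preconnected)
    (hσ : ∀ f, σ.FaceIsSimpleCycle f) {F F' : Set σ.Face} (h : σ.ringSum F = σ.ringSum F')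
    {f : σ.Face} (hf : f ∈ F ↔ f ∈ F') : F = F' := by
  obtain ⟨d, rfl⟩ := σ.faceOf_surjective f
  have hs : ∀ a : G.Dart, (σ.faceOf a ∈ F ↔ σ.faceOf a ∈ F') →
      (σ.faceOf a.symm ∈ F ↔ σ.faceOf a.symm ∈ F') := by
    intro a ha
    have h1 := edge_mem_ringSum_iff hσ (F := F) (d := a)
    have h2 := edge_mem_ringSum_iff hσ (F := F') (d := a)
    rw [h] at h1
    tauto
  ext g
  obtain ⟨d', rfl⟩ := σ.faceOf_surjective g
  refine σ.dart_induction (p := fun a => σ.faceOf a ∈ F ↔ σ.faceOf a ∈ F') hG ?_ hs hf d'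
  intro a ha
  rw [faceOf_next]
  exact hs a ha

end Finite

/-! ### Components of the drawing cut along `T` -/

section Component

variable {T : Set (Sym2 V)}

theorem adjacentOff_faceOf_symm {d : G.Dart} (h : d.edge ∉ T) :
    σ.AdjacentOff T (σ.faceOf d) (σ.faceOf d.symm) :=
  ⟨d.edge, h, σ.edge_mem_faceEdges_iff.2 (.inl rfl), σ.edge_mem_faceEdges_iff.2 (.inr rfl)⟩

/-- The faces which can be reached from a given face without crossing an edge of `T`. -/
def component (T : Set (Sym2 V)) (f : σ.Face) : Set σ.Face :=
  {g | Relation.ReflTransGen (σ.AdjacentOff T) f g}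

variable {σ}

theorem mem_component_self {f : σ.Face} : f ∈ σ.component T f := Relation.ReflTransGen.refl

theorem AdjacentOff.symm {f g : σ.Face} (h : σ.AdjacentOff T f g) : σ.AdjacentOff T g f := by
  obtain ⟨e, he, hf, hg⟩ := h
  exact ⟨e, he, hg, hf⟩

theorem component_eq {f g : σ.Face} (h : g ∈ σ.component T f) :
    σ.component T g = σ.component T f := by
  have h' : Relation.ReflTransGen (σ.AdjacentOff T) g f :=
    have : Std.Symm (σ.AdjacentOff T) := ⟨fun _ _ => AdjacentOff.symm⟩
    Std.Symm.symm _ _ h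
  ext k
  exact ⟨fun hk => Relation.ReflTransGen.trans h hk, fun hk => Relation.ReflTransGen.trans h' hk⟩

theorem mem_component_iff {f g : σ.Face} :
    g ∈ σ.component T f ↔ σ.component T g = σ.component T f :=
  ⟨component_eq, fun h => h ▸ mem_component_self⟩

theorem mem_component_of_adjacentOff {f g k : σ.Face} (h : g ∈ σ.component T f)
    (hk : σ.AdjacentOff T g k) : k ∈ σ.component T f := Relation.ReflTransGen.tail h hk

theorem component_subset {F : Set σ.Face} {f : σ.Face} (hf : f ∈ F)
    (hF : ∀ g ∈ F, ∀ k, σ.AdjacentOff T g k → k ∈ F) : σ.component T f ⊆ F := by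
  intro g hg
  induction hg with
  | refl => exact hf
  | tail _ h ih => exact hF _ ih _ h

theorem mem_of_adjacentOff_of_ringSum_subset (hσ : ∀ f, σ.FaceIsSimpleCycle f) {F : Set σ.Face}
    (hF : σ.ringSum F ⊆ T) {f g : σ.Face} (hf : f ∈ F) (h : σ.AdjacentOff T f g) : g ∈ F := by
  obtain ⟨e, he, ⟨d, rfl, rfl⟩, hg⟩ := h
  have := mt (@hF d.edge) he
  rw [edge_mem_ringSum_iff hσ, not_not] at this
  rcases σ.edge_mem_faceEdges_iff.1 hg with rfl | rfl
  · exact hf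
  · exact this.1 hf

/-- Membership in `F` changes only across edges of its ring sum, so `F` is a union of components. -/
theorem component_subset_of_ringSum_subset (hσ : ∀ f, σ.FaceIsSimpleCycle f) {F : Set σ.Face}
    (hF : σ.ringSum F ⊆ T) {f : σ.Face} (hf : f ∈ F) : σ.component T f ⊆ F :=
  component_subset hf fun _ hg _ h => mem_of_adjacentOff_of_ringSum_subset hσ hF hg h

theorem ringSum_component_subset (hσ : ∀ f, σ.FaceIsSimpleCycle f) (f : σ.Face) :
    σ.ringSum (σ.component T f) ⊆ T := by
  intro e he
  obtain ⟨d, rfl⟩ := exists_dart_of_mem_edgeSet (σ.ringSum_subset _ he)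
  rw [edge_mem_ringSum_iff hσ] at he
  by_contra heT
  have h := σ.adjacentOff_faceOf_symm heT
  exact he ⟨fun h' => mem_component_of_adjacentOff h' h,
    fun h' => mem_component_of_adjacentOff h' h.symm⟩

/-- Between two edges `a` and `b` at a vertex, no other edge of `T` being there, one can pass from
the face behind `a` to the face before `b`. -/
theorem faceOf_mem_component_of_corner [Fintype V] {a b : G.Dart} (hab : a.fst = b.fst)
    (h : ∀ x : G.Dart, x.fst = a.fst → x.edge ∈ T → x = a ∨ x = b) :
    σ.faceOf b ∈ σ.component T (σ.faceOf a.symm) := by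
  -- Turn from `next a` around the vertex. The only edges of `T` met are those of `a`, behind which
  -- the starting face lies again, and of `b`, which under `hb` is never reached inside the
  -- component.
  by_contra hb
  refine hb (σ.next_induction (p := fun x => σ.faceOf x ∈ σ.component T (σ.faceOf a.symm))
    (d := σ.next a) ((σ.fst_next a).trans hab) ?_ ?_)
  · intro x hx hxc
    rw [faceOf_next]
    by_cases hxT : x.edge ∈ T
    · rcases h x (hx.trans (σ.fst_next a)) hxT with rfl | rfl
      · exact mem_component_self
      · exact absurd hxc hb
    · exact mem_component_of_adjacentOff hxc (σ.adjacentOff_faceOf_symm hxT)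
  · rw [faceOf_next]
    exact mem_component_self

/-- The condition concerns consecutive darts, so the tail of the walk inherits it; each induction
step turns one corner. -/
theorem component_eq_of_mem_darts_aux [Fintype V] {u v : V} (Q : G.Walk u v)
    (h : ∀ d ∈ Q.darts, ∀ d' ∈ Q.darts, d.snd = d'.fst →
      ∀ x : G.Dart, x.fst = d'.fst → x.edge ∈ T → x = d.symm ∨ x = d') :
    ∃ F, ∀ d ∈ Q.darts, σ.component T (σ.faceOf d) = F := by
  induction Q with
  | nil => exact ⟨∅, by simp⟩
  | @cons x y z hxy q ih =>
    cases q with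
    | nil => exact ⟨σ.component T (σ.faceOf ⟨(x, y), hxy⟩), by simp⟩
    | @cons _ w _ hyw q =>
      obtain ⟨F, hF⟩ := ih fun d hd d' hd' =>
        h d (by rw [Walk.darts_cons]; exact List.mem_cons_of_mem _ hd)
          d' (by rw [Walk.darts_cons]; exact List.mem_cons_of_mem _ hd')
      refine ⟨F, fun d hd => ?_⟩
      rw [Walk.darts_cons, List.mem_cons] at hd
      rcases hd with rfl | hd
      · rw [← hF ⟨(y, w), hyw⟩ (by simp)]
        refine (component_eq (faceOf_mem_component_of_corner
          (b := ⟨(y, w), hyw⟩) (a := (⟨(x, y), hxy⟩ : G.Dart).symm) rfl ?_)).symm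
        exact h ⟨(x, y), hxy⟩ (by simp) ⟨(y, w), hyw⟩ (by simp) rfl
      · exact hF d hd

/-- The faces on one side of a path are in one component if all edges of `T` at inner vertices of
the path belong to the path. -/
theorem component_eq_of_mem_darts [Fintype V] {u v : V} {Q : G.Walk u v} (hQ : Q.IsPath)
    (h : ∀ x : G.Dart, x.edge ∈ T → x.fst ∈ Q.support → x.fst ≠ u → x.fst ≠ v →
      x.edge ∈ Q.edges) {d d' : G.Dart} (hd : d ∈ Q.darts) (hd' : d' ∈ Q.darts) :
    σ.component T (σ.faceOf d) = σ.component T (σ.faceOf d') := by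
  obtain ⟨F, hF⟩ := component_eq_of_mem_darts_aux (σ := σ) (T := T) Q (by
    intro a ha b hb hab x hx hxT
    rcases Walk.mem_darts_or_symm_mem_darts (h x hxT
      (hx ▸ Q.dart_fst_mem_support_of_mem_darts hb)
      (by rw [hx, ← hab]; exact hQ.snd_ne_start ha) (by rw [hx]; exact hQ.fst_ne_end hb))
      with h1 | h1
    · exact .inr (hQ.eq_of_fst_eq h1 hb hx)
    · left
      rw [← hQ.eq_of_snd_eq h1 ha (hx.trans hab.symm), Dart.symm_symm])
  rw [hF d hd, hF d' hd']

theorem component_symm_eq_of_mem_darts [Fintype V] {u v : V} {Q : G.Walk u v} (hQ : Q.IsPath)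
    (h : ∀ x : G.Dart, x.edge ∈ T → x.fst ∈ Q.support → x.fst ≠ u → x.fst ≠ v →
      x.edge ∈ Q.edges) {d d' : G.Dart} (hd : d ∈ Q.darts) (hd' : d' ∈ Q.darts) :
    σ.component T (σ.faceOf d.symm) = σ.component T (σ.faceOf d'.symm) :=
  component_eq_of_mem_darts hQ.reverse (fun x h1 h2 h3 h4 => by
      simpa using h x h1 (by simpa using h2) h4 h3)
    (by simpa using hd) (by simpa using hd')

/-- A face of the component without inner edges has no neighbour, so it is the whole component.
Hence either the faces through inner edges are exactly the component, or the component is a single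
face. -/
theorem partGivesCycle_of_component [Fintype V] {f : σ.Face} {A P : Set (Sym2 V)}
    (hc : IsSimpleCycleSet G (A ∪ P)) (hr : σ.ringSum (σ.component T f) = A ∪ P) :
    σ.PartGivesCycle T (σ.component T f) A P := by
  have key : (σ.innerEdges T (σ.component T f)).Nonempty →
      σ.ringSum (σ.facesThrough (σ.innerEdges T (σ.component T f))) = A ∪ P := by
    rintro ⟨e₀, he₀, f₀, hf₀, hef₀⟩
    rw [← hr]
    congr 1
    ext g
    constructor
    · rintro ⟨e, ⟨heT, k, hk, hek⟩, heg⟩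
      exact mem_component_of_adjacentOff hk ⟨e, heT, hek, heg⟩
    · intro hg
      by_contra hn
      have hsub : σ.component T f ⊆ {g} := by
        rw [← component_eq hg]
        refine component_subset rfl ?_
        rintro _ rfl k ⟨e, he, h1, -⟩
        exact absurd ⟨e, ⟨he, _, hg, h1⟩, h1⟩ hn
      obtain rfl : f₀ = g := hsub hf₀
      exact hn ⟨e₀, ⟨he₀, _, hf₀, hef₀⟩, hef₀⟩
  refine ⟨hc, key, ?_, ?_⟩
  · rintro ⟨x₀, hx₀⟩ hall
    -- No edge at an inner vertex is in `T`, so one can turn all around it within the component.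
    have hedge : ∀ x ∈ σ.innerVertices T (σ.component T f), ∀ d : G.Dart, d.fst = x →
        d.edge ∈ σ.innerEdges T (σ.component T f) := by
      rintro x ⟨hxT, g, hg, d₀, rfl, rfl⟩ d hd
      have hT : ∀ a : G.Dart, a.fst = d₀.fst → a.edge ∉ T := by
        intro a ha haT
        refine hxT _ haT ?_
        rw [← ha]
        exact Sym2.mem_mk_left _ _
      refine ⟨hT d hd, σ.faceOf d, ?_, d, rfl, rfl⟩
      refine σ.next_induction (p := fun a => σ.faceOf a ∈ σ.component T f) hd.symm ?_ hg
      intro a ha hac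
      rw [faceOf_next]
      exact mem_component_of_adjacentOff hac (σ.adjacentOff_faceOf_symm (hT a ha))
    have heq : σ.edgesAtInnerVertices T (σ.component T f)
        = σ.innerEdges T (σ.component T f) := by
      ext e
      constructor
      · rintro ⟨he, x, hx, hxe⟩
        obtain ⟨d, rfl⟩ := exists_dart_of_mem_edgeSet he
        rcases Sym2.mem_iff.1 hxe with rfl | rfl
        · exact hedge _ hx d rfl
        · rw [← Dart.edge_symm]
          exact hedge _ hx d.symm rfl
      · intro he
        obtain ⟨-, g, -, hg⟩ := id he
        exact ⟨σ.faceEdges_subset g hg, hall e he⟩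
    rw [heq]
    refine key ?_
    obtain ⟨-, g, hg, d, -, hd⟩ := id hx₀
    exact ⟨_, hedge x₀ hx₀ d hd⟩
  · intro he
    have : σ.component T f = {f} := by
      refine Set.Subset.antisymm (component_subset rfl ?_)
        (Set.singleton_subset_iff.2 mem_component_self)
      rintro g hg k ⟨e, heT, h1, -⟩
      rw [Set.mem_singleton_iff.1 hg] at h1
      have : e ∈ σ.innerEdges T (σ.component T f) := ⟨heT, _, mem_component_self, h1⟩
      rw [he] at this
      exact this.elim
    exact ⟨f, this, by rw [← hr, this, ringSum_singleton]⟩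

theorem part_eq_component {D : Set G.Dart} {d₀ : G.Dart} (h₀ : d₀ ∈ D)
    (h : ∀ d ∈ D, σ.component T (σ.faceOf d) = σ.component T (σ.faceOf d₀)) :
    σ.part T D = σ.component T (σ.faceOf d₀) := by
  ext f
  constructor
  · rintro ⟨d, hd, hf⟩
    rw [← h d hd]
    exact hf
  · exact fun hf => ⟨d₀, h₀, hf⟩

end Component

/-! ### Boundaries of the components cut out by a theta graph -/

section Theta

variable [Fintype V] {σ} {T : Set (Sym2 V)}

/-- The boundary of a component contains all or none of the edges of a path whose inner vertices
lie on no further edges of `T`. -/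
theorem edgeSet_subset_or_disjoint_ringSum_component (hσ : ∀ f, σ.FaceIsSimpleCycle f)
    {u v : V} {Q : G.Walk u v} (hQ : Q.IsPath)
    (h : ∀ x : G.Dart, x.edge ∈ T → x.fst ∈ Q.support → x.fst ≠ u → x.fst ≠ v →
      x.edge ∈ Q.edges) (f : σ.Face) :
    Q.edgeSet ⊆ σ.ringSum (σ.component T f) ∨
      Disjoint Q.edgeSet (σ.ringSum (σ.component T f)) := by
  rw [or_iff_not_imp_right, Set.not_disjoint_iff]
  rintro ⟨e, he, heX⟩ e' he'
  obtain ⟨d, hd, rfl⟩ := List.mem_map.1 he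
  obtain ⟨d', hd', rfl⟩ := List.mem_map.1 he'
  -- Whether an edge is on the boundary depends only on the components on its two sides, and these
  -- are constant along `Q`.
  rw [edge_mem_ringSum_iff hσ, mem_component_iff, mem_component_iff] at heX ⊢
  rwa [component_eq_of_mem_darts hQ h hd' hd, component_symm_eq_of_mem_darts hQ h hd' hd]

/-- The boundary of a component of the drawing cut along a theta graph, when it contains one of the
three paths, consists of this path and another one. -/
theorem ringSum_component_eq_of_theta (hσ : ∀ f, σ.FaceIsSimpleCycle f) {u v : V} (huv : u ≠ v)
    {A B P : G.Walk u v} (hA : A.IsPath) (hB : B.IsPath) (hP : P.IsPath)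
    (hC : IsSimpleCycleSet G (A.edgeSet ∪ B.edgeSet))
    (hPe : Disjoint (A.edgeSet ∪ B.edgeSet) P.edgeSet)
    (hT : T = A.edgeSet ∪ B.edgeSet ∪ P.edgeSet)
    (hTA : ∀ x : G.Dart, x.edge ∈ T → x.fst ∈ A.support → x.fst ≠ u → x.fst ≠ v →
      x.edge ∈ A.edges)
    (hTB : ∀ x : G.Dart, x.edge ∈ T → x.fst ∈ B.support → x.fst ≠ u → x.fst ≠ v →
      x.edge ∈ B.edges)
    (hTP : ∀ x : G.Dart, x.edge ∈ T → x.fst ∈ P.support → x.fst ≠ u → x.fst ≠ v →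
      x.edge ∈ P.edges) {f : σ.Face} {d : G.Dart} (hd : d ∈ P.darts)
    (hdX : d.edge ∈ σ.ringSum (σ.component T f)) :
    σ.ringSum (σ.component T f) = A.edgeSet ∪ P.edgeSet ∨
      σ.ringSum (σ.component T f) = B.edgeSet ∪ P.edgeSet := by
  have hXT := ringSum_component_subset (T := T) hσ f
  have hXq := edgeVector_ringSum_mem hσ (σ.component T f)
  have hXP := (edgeSet_subset_or_disjoint_ringSum_component hσ hP hTP f).resolve_right
    (Set.not_disjoint_iff.2 ⟨_, Walk.edge_mem_edges hd, hdX⟩)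
  have hXA := edgeSet_subset_or_disjoint_ringSum_component hσ hA hTA f
  have hXB := edgeSet_subset_or_disjoint_ringSum_component hσ hB hTB f
  generalize σ.ringSum (σ.component T f) = X at *
  have hPq := mt (edgeVector_mem_quasicycleSpace_iff hP.isTrail).1 huv
  rw [hT] at hXT
  -- If both arcs or neither are present, the quasicycle is a cycle plus `P`, or `P` alone; both
  -- contradict that `P`, having distinct ends, is no quasicycle.
  rcases hXA with hXA | hXA <;> rcases hXB with hXB | hXB
  · have hX : X = A.edgeSet ∪ B.edgeSet ∪ P.edgeSet :=
      hXT.antisymm (Set.union_subset (Set.union_subset hXA hXB) hXP)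
    rw [hX, edgeVector_union hPe] at hXq
    exact absurd ((Submodule.add_mem_iff_right _ hC.edgeVector_mem).1 hXq) hPq
  · left
    refine Set.Subset.antisymm (fun e he => ?_) (Set.union_subset hXA hXP)
    rcases hXT he with (h | h) | h
    · exact .inl h
    · exact absurd he (Set.disjoint_left.1 hXB h)
    · exact .inr h
  · right
    refine Set.Subset.antisymm (fun e he => ?_) (Set.union_subset hXB hXP)
    rcases hXT he with (h | h) | h
    · exact absurd he (Set.disjoint_left.1 hXA h)
    · exact .inl h
    · exact .inr h
  · have hX : X = P.edgeSet := by
      refine Set.Subset.antisymm (fun e he => ?_) hXP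
      rcases hXT he with (h | h) | h
      · exact absurd he (Set.disjoint_left.1 hXA h)
      · exact absurd he (Set.disjoint_left.1 hXB h)
      · exact h
    exact absurd (hX ▸ hXq) hPq

/-- A cycle through an edge bounds a set of faces which contains the face on a given side of the
edge, but not the face on the other side. -/
theorem exists_ringSum_eq_of_isSimpleCycleSet (hσ : σ.IsPlaneDrawing) {S : Set (Sym2 V)}
    (hS : IsSimpleCycleSet G S) {d : G.Dart} (hd : d.edge ∈ S) :
    ∃ R : Set σ.Face, σ.ringSum R = S ∧ σ.faceOf d ∈ R ∧ σ.faceOf d.symm ∉ R := by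
  obtain ⟨R, hR⟩ := hσ.2.exists_ringSum_eq hS.subset_edgeSet hS.edgeVector_mem
  have h := hd
  rw [← hR, edge_mem_ringSum_iff hσ.1] at h
  -- The complement has the same ring sum, so the side of `d` can be chosen.
  by_cases hl : σ.faceOf d ∈ R
  · exact ⟨R, hR, hl, by tauto⟩
  · refine ⟨Rᶜ, (ringSum_compl hσ.1 R).trans hR, hl, ?_⟩
    rw [Set.mem_compl_iff]
    tauto

end Theta

end GraphRotation

/-! ### The two parts adjacent to the path -/

open GraphRotation

theorem mainTheorem2 {V : Type*} [Fintype V] (G : SimpleGraph V) (hG : IsNonseparable G)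
    (σ : GraphRotation G) (hσ : σ.IsPlaneDrawing)
    {c : V} (C : G.Walk c c) (hC : C.IsCycle)
    {u v : V} (huv : u ≠ v) (hu : u ∈ C.support) (hv : v ∈ C.support)
    (P : G.Walk u v) (hP : P.IsPath)
    (hPC : ∀ x ∈ P.support, x ∈ C.support → x = u ∨ x = v)
    (hPe : Disjoint P.edgeSet C.edgeSet) :
    ∃ A₁ A₂ : G.Walk u v, A₁.IsPath ∧ A₂.IsPath ∧
      Disjoint A₁.edgeSet A₂.edgeSet ∧ A₁.edgeSet ∪ A₂.edgeSet = C.edgeSet ∧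
      σ.PartGivesCycle (C.edgeSet ∪ P.edgeSet)
        (σ.part (C.edgeSet ∪ P.edgeSet) {d | d ∈ P.darts}) A₁.edgeSet P.edgeSet ∧
      σ.PartGivesCycle (C.edgeSet ∪ P.edgeSet)
        (σ.part (C.edgeSet ∪ P.edgeSet) {d | d.symm ∈ P.darts}) A₂.edgeSet P.edgeSet := by
  obtain ⟨A, B, hA, hB, hAB, hABe, hABC, hAC, hBC⟩ := hC.exists_arcs huv hu hv
  obtain ⟨d₀, hd₀⟩ := Walk.exists_mem_darts (p := P) huv
  have hd₀P : d₀.edge ∈ P.edgeSet := Walk.edge_mem_edges hd₀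
  have hcyc : IsSimpleCycleSet G (A.edgeSet ∪ B.edgeSet) := ⟨c, C, hC, hABC.symm⟩
  rw [← hABC] at hPe ⊢
  have hcA : IsSimpleCycleSet G (A.edgeSet ∪ P.edgeSet) :=
    hA.isSimpleCycleSet_union hP huv (fun x h h' => hPC x h' (hAC h))
      (hPe.mono_right Set.subset_union_left).symm
  have hcB : IsSimpleCycleSet G (B.edgeSet ∪ P.edgeSet) :=
    hB.isSimpleCycleSet_union hP huv (fun x h h' => hPC x h' (hBC h))
      (hPe.mono_right Set.subset_union_right).symm
  obtain ⟨T, hT⟩ : ∃ T, T = A.edgeSet ∪ B.edgeSet ∪ P.edgeSet := ⟨_, rfl⟩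
  rw [← hT]
  have hsupp : ∀ {Q : G.Walk u v} {x : G.Dart}, x.edge ∈ Q.edgeSet → x.fst ∈ Q.support :=
    fun {Q x} hx => Q.fst_mem_support_of_mem_edges (u := x.snd) hx
  have hTA : ∀ x : G.Dart, x.edge ∈ T → x.fst ∈ A.support → x.fst ≠ u → x.fst ≠ v →
      x.edge ∈ A.edges := by
    intro x hxT hx h1 h2
    rw [hT] at hxT
    rcases hxT with (h | h) | h
    · exact h
    · exact absurd (hAB _ hx (hsupp h)) (by tauto)
    · exact absurd (hPC _ (hsupp h) (hAC hx)) (by tauto)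
  have hTB : ∀ x : G.Dart, x.edge ∈ T → x.fst ∈ B.support → x.fst ≠ u → x.fst ≠ v →
      x.edge ∈ B.edges := by
    intro x hxT hx h1 h2
    rw [hT] at hxT
    rcases hxT with (h | h) | h
    · exact absurd (hAB _ (hsupp h) hx) (by tauto)
    · exact h
    · exact absurd (hPC _ (hsupp h) (hBC hx)) (by tauto)
  have hTP : ∀ x : G.Dart, x.edge ∈ T → x.fst ∈ P.support → x.fst ≠ u → x.fst ≠ v →
      x.edge ∈ P.edges := by
    intro x hxT hx h1 h2
    rw [hT] at hxT
    rcases hxT with (h | h) | h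
    · exact absurd (hPC _ hx (hAC (hsupp h))) (by tauto)
    · exact absurd (hPC _ hx (hBC (hsupp h))) (by tauto)
    · exact h
  have hF₁ : σ.part T {d | d ∈ P.darts} = σ.component T (σ.faceOf d₀) :=
    part_eq_component hd₀ fun d hd => component_eq_of_mem_darts hP hTP hd hd₀
  have hF₂ : σ.part T {d | d.symm ∈ P.darts} = σ.component T (σ.faceOf d₀.symm) := by
    refine part_eq_component (d₀ := d₀.symm) (by simpa using hd₀) fun d hd => ?_
    simpa using component_symm_eq_of_mem_darts hP hTP (d := d.symm) hd hd₀
  -- `R` is taken on the side of `d₀` and `R'` on the opposite side, so that each contains the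
  -- component on its own side and misses the other one.
  obtain ⟨R, hR, hlR, hrR⟩ := exists_ringSum_eq_of_isSimpleCycleSet hσ hcA (.inr hd₀P)
  obtain ⟨R', hR', hrR', hlR'⟩ :=
    exists_ringSum_eq_of_isSimpleCycleSet hσ hcB (d := d₀.symm) (.inr (by simpa using hd₀P))
  rw [Dart.symm_symm] at hlR'
  have hRT : σ.ringSum R ⊆ T := by
    rw [hR, hT]
    exact Set.union_subset_union_left _ Set.subset_union_left
  have hRT' : σ.ringSum R' ⊆ T := by
    rw [hR', hT]
    exact Set.union_subset_union_left _ Set.subset_union_right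
  have h1 := component_subset_of_ringSum_subset hσ.1 hRT hlR
  have h2 := component_subset_of_ringSum_subset hσ.1 hRT' hrR'
  have h3 := component_subset_of_ringSum_subset hσ.1
    ((ringSum_compl hσ.1 R').trans_subset hRT') (show σ.faceOf d₀ ∈ R'ᶜ from hlR')
  have h4 := component_subset_of_ringSum_subset hσ.1
    ((ringSum_compl hσ.1 R).trans_subset hRT) (show σ.faceOf d₀.symm ∈ Rᶜ from hrR)
  have hl : σ.faceOf d₀ ∈ σ.component T (σ.faceOf d₀) := mem_component_self
  have hr : σ.faceOf d₀.symm ∈ σ.component T (σ.faceOf d₀.symm) := mem_component_self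
  have htheta : ∀ f, d₀.edge ∈ σ.ringSum (σ.component T f) → _ := fun f =>
    ringSum_component_eq_of_theta hσ.1 huv hA hB hP hcyc hPe.symm hT hTA hTB hTP hd₀
  have hX₁ := htheta (σ.faceOf d₀)
    ((edge_mem_ringSum_iff hσ.1).2 fun h => hrR (h1 (h.1 hl)))
  have hX₂ := htheta (σ.faceOf d₀.symm)
    ((edge_mem_ringSum_iff hσ.1).2 fun h => hlR' (h2 (h.2 hr)))
  have hne : σ.ringSum (σ.component T (σ.faceOf d₀))
      ≠ σ.ringSum (σ.component T (σ.faceOf d₀.symm)) := by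
    intro h
    -- The component of `d₀` and the complement of the other one both contain the face at `d₀`, so
    -- equal ring sums make them equal.
    rw [← ringSum_compl hσ.1 (σ.component T (σ.faceOf d₀.symm))] at h
    have hcompl := eq_of_ringSum_eq hG.1.preconnected hσ.1 h (f := σ.faceOf d₀)
      ⟨fun _ h' => hlR' (h2 h'), fun _ => hl⟩
    -- The two components now exhaust all faces, so `R` and `R'ᶜ` both equal the component of `d₀`.
    have hRR' : R = R'ᶜ := by
      ext g
      by_cases hg : g ∈ σ.component T (σ.faceOf d₀)
      · exact ⟨fun _ => h3 hg, fun _ => h1 hg⟩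
      · rw [hcompl, Set.mem_compl_iff, not_not] at hg
        exact ⟨fun h' => absurd h' (h4 hg), fun h' => absurd (h2 hg) h'⟩
    have hAP : A.edgeSet ∪ P.edgeSet = B.edgeSet ∪ P.edgeSet := by
      rw [← hR, ← hR', hRR', ringSum_compl hσ.1]
    obtain ⟨a, ha⟩ := Walk.exists_mem_darts (p := A) huv
    have haA : a.edge ∈ A.edgeSet := Walk.edge_mem_edges ha
    rcases hAP.subset (.inl haA) with h' | h'
    · exact Set.disjoint_left.1 hABe haA h'
    · exact Set.disjoint_left.1 hPe h' (.inl haA)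
  rw [hF₁, hF₂]
  rcases hX₁ with hX₁ | hX₁ <;> rcases hX₂ with hX₂ | hX₂
  · exact absurd (hX₁.trans hX₂.symm) hne
  · exact ⟨A, B, hA, hB, hABe, rfl, partGivesCycle_of_component hcA hX₁,
      partGivesCycle_of_component hcB hX₂⟩
  · exact ⟨B, A, hB, hA, hABe.symm, Set.union_comm _ _, partGivesCycle_of_component hcB hX₁,
      partGivesCycle_of_component hcA hX₂⟩
  · exact absurd (hX₁.trans hX₂.symm) hne
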